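/- For a two-qubit density operator $\sigma$ on $\mathbb C^2\otimes\mathbb C^2$ put $\tilde\sigma=(\sigma_y\otimes\sigma_y)\,\sigma^*\,(\sigma_y\otimes\sigma_y)$, where $\sigma_y=\begin{pmatrix}0&-i\\ i&0\end{pmatrix}$ and $\sigma^*$ is the entrywise complex conjugate in the standard product basis, and define the harmony $$H(\sigma)=\max\{0,\;2\operatorname{tr}[(\sigma\tilde\sigma)^2]-[\operatorname{tr}(\sigma\tilde\sigma)]^2-8\det\sigma\}.$$ For a unit vector $\psi\in\mathbb C^2_X\otimes(\mathbb C^2_Y\otimes\mathbb C^2_Z)$ there are an isometry $V:\mathbb C^2\to\mathbb C^2_Y\otimes\mathbb C^2_Z$ and a vector $\varphi\in\mathbb C^2_X\otimes\mathbb C^2$ with $\psi=(1\otimes V)\varphi$; put $H_{X(YZ)}(\psi)=H(|\varphi\rangle\langle\varphi|)$, which does not depend on the choice of $V$ and $\varphi$ (it equals $(4\det\rho_X)^2$, where $\rho_X$ is the reduced state of $|\psi\rangle\langle\psi|$ on $X$). Proposition. Let $\rho$ be a (possibly mixed) state of three qubits $X,Y,Z$, i.e. a positive semidefinite operator of trace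 one on $\mathbb C^2_X\otimes\mathbb C^2_Y\otimes\mathbb C^2_Z$, with reduced states $\rho_{XY}=\operatorname{tr}_Z\rho$ and $\rho_{XZ}=\operatorname{tr}_Y\rho$. Then the minimum $$(H^{1/2})^{\min}_{X(YZ)}=\min\sum_{i=1}^{K}p_i\sqrt{H_{X(YZ)}(\psi_i)}$$ over all finite pure-state decompositions $\rho=\sum_{i=1}^K p_i|\psi_i\rangle\langle\psi_i|$ ($K$ arbitrary, $p_i\ge0$, $\sum_i p_i=1$, $\|\psi_i\|=1$) exists, and $$H(\rho_{XY})^2+H(\rho_{XZ})^2\le (H^{1/2})^{\min}_{X(YZ)}.$$ -/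

import Mathlib

open scoped Matrix Kronecker ComplexOrder

namespace Harmony

/-- Basis labels of one, two and three qubits (in the order `X`, `Y`, `Z`). -/
abbrev Q1 := Fin 2
abbrev Q2 := Q1 × Q1
abbrev Q3 := Q1 × Q1 × Q1

/-- A density operator: positive semidefinite with trace one. -/
def IsDensity {n : Type*} [Fintype n] (ρ : Matrix n n ℂ) : Prop :=
  ρ.PosSemidef ∧ ρ.trace = 1

/-- A normalized state vector. -/
def IsUnitVec {n : Type*} [Fintype n] (ψ : n → ℂ) : Prop :=
  ∑ i, ‖ψ i‖ ^ 2 = 1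

/-- The operator `|ψ⟩⟨ψ|`. -/
def proj {n : Type*} (ψ : n → ℂ) : Matrix n n ℂ :=
  Matrix.vecMulVec ψ (star ψ)

/-- The partial trace over the second factor. -/
def ptraceRight {m n : Type*} [Fintype n] (ρ : Matrix (m × n) (m × n) ℂ) : Matrix m m ℂ :=
  Matrix.of fun x x' => ∑ w, ρ (x, w) (x', w)

/-- The reduced state of the qubits `X` and `Y`. -/
def reduceXY (ρ : Matrix Q3 Q3 ℂ) : Matrix Q2 Q2 ℂ :=
  Matrix.of fun a b => ∑ z, ρ (a.1, a.2, z) (b.1, b.2, z)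

/-- The reduced state of the qubits `X` and `Z`. -/
def reduceXZ (ρ : Matrix Q3 Q3 ℂ) : Matrix Q2 Q2 ℂ :=
  Matrix.of fun a b => ∑ y, ρ (a.1, y, a.2) (b.1, y, b.2)

/-- The Pauli matrix `σ_y`. -/
def sigmaY : Matrix Q1 Q1 ℂ :=
  !![0, -Complex.I; Complex.I, 0]

/-- The spin flip `(σ_y ⊗ σ_y) ρ^* (σ_y ⊗ σ_y)`, with the entrywise conjugate `ρ^*`. -/
noncomputable def spinFlip (ρ : Matrix Q2 Q2 ℂ) : Matrix Q2 Q2 ℂ :=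
  (sigmaY ⊗ₖ sigmaY) * ρ.map (starRingEnd ℂ) * (sigmaY ⊗ₖ sigmaY)

/-- The harmony of a two-qubit state. For a density operator the quantity
whose real part is taken is real. -/
noncomputable def harmony (ρ : Matrix Q2 Q2 ℂ) : ℝ :=
  max 0 (2 * ((ρ * spinFlip ρ) ^ 2).trace - (ρ * spinFlip ρ).trace ^ 2 - 8 * ρ.det).re

/-- `φ` is `ψ` seen as a state of `X` and one further qubit: the pair `YZ` is restricted to
a two-dimensional subspace, identified with a qubit by the isometry `V`. -/
def IsEffective (ψ : Q3 → ℂ) (φ : Q2 → ℂ) : Prop :=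
  ∃ V : Matrix Q2 Q1 ℂ, Vᴴ * V = 1 ∧ ψ = ((1 : Matrix Q1 Q1 ℂ) ⊗ₖ V) *ᵥ φ

lemma isEffective_apply {V : Matrix Q2 Q1 ℂ} {φ : Q2 → ℂ} (x : Q1) (u : Q2) :
    (((1 : Matrix Q1 Q1 ℂ) ⊗ₖ V) *ᵥ φ) (x, u) = ∑ w, V u w * φ (x, w) := by
  simp only [Matrix.mulVec, dotProduct, Fintype.sum_prod_type, Matrix.kroneckerMap_apply,
    Matrix.one_apply]
  fin_cases x <;> simp

theorem exists_isEffective (ψ : Q3 → ℂ) : ∃ φ, IsEffective ψ φ := by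
  let E := EuclideanSpace ℂ Q2
  let f : Fin 4 → E := ![WithLp.toLp 2 fun u => ψ (0, u), WithLp.toLp 2 fun u => ψ (1, u), 0, 0]
  have hd : Module.finrank ℂ E = Fintype.card (Fin 4) := by simp [E]
  let b := InnerProductSpace.gramSchmidtOrthonormalBasis hd f
  have key : ∀ x : Q1, (WithLp.toLp 2 fun u => ψ (x, u) : E) =
      ∑ w : Q1, inner ℂ (b (Fin.castLE (by norm_num) w)) (WithLp.toLp 2 fun u => ψ (x, u) : E) •
        b (Fin.castLE (by norm_num) w) := by
    intro x
    have h := b.sum_repr' (WithLp.toLp 2 fun u => ψ (x, u))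
    have hz : ∀ j : Fin 4, 2 ≤ j → inner ℂ (b j) (WithLp.toLp 2 fun u => ψ (x, u) : E) = 0 := by
      intro j hj
      have h1 := InnerProductSpace.gramSchmidtOrthonormalBasis_inv_triangular hd f
        (i := Fin.castLE (by norm_num) x) (j := j) (by
          rw [Fin.lt_def]; rw [Fin.le_def] at hj; simp at hj ⊢; omega)
      fin_cases x <;> exact h1
    rw [Fin.sum_univ_four, hz 2 (by decide), hz 3 (by decide)] at h
    rw [Fin.sum_univ_two]
    simpa using h.symm
  refine ⟨fun a => inner ℂ (b (Fin.castLE (by norm_num) a.2))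
    (WithLp.toLp 2 fun u => ψ (a.1, u) : E),
    Matrix.of fun u w => b (Fin.castLE (by norm_num) w) u, ?_, ?_⟩
  · ext w w'
    have h := orthonormal_iff_ite.mp b.orthonormal (Fin.castLE (by norm_num : 2 ≤ 4) w)
      (Fin.castLE (by norm_num : 2 ≤ 4) w')
    rw [PiLp.inner_apply] at h
    simp only [Matrix.mul_apply, Matrix.conjTranspose_apply, Matrix.of_apply, Matrix.one_apply]
    simpa [mul_comm] using h
  · ext ⟨x, u⟩
    rw [isEffective_apply]
    have h := congrArg (fun v : E => v u) (key x)
    simp [Fin.sum_univ_two] at h ⊢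
    refine h.trans ?_
    rw [PiLp.add_apply, PiLp.smul_apply, PiLp.smul_apply, smul_eq_mul, smul_eq_mul]
    ring

theorem harmony_proj (φ : Q2 → ℂ) :
    harmony (proj φ) = (4 * (ptraceRight (proj φ)).det.re) ^ 2 := by
  have hdet : (proj φ).det = 0 := Matrix.det_vecMulVec _ _
  set d : ℂ := φ (0, 0) * φ (1, 1) - φ (0, 1) * φ (1, 0) with hd
  have htr : (proj φ * spinFlip (proj φ)).trace = 4 * (d * star d) := by
    simp only [spinFlip, proj, sigmaY, Matrix.trace, Matrix.diag, Matrix.mul_apply,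
      Fintype.sum_prod_type, Fin.sum_univ_two, Matrix.kroneckerMap_apply, Matrix.vecMulVec_apply,
      Matrix.map_apply, hd]
    simp
    ring_nf
  have hsq : ((proj φ * spinFlip (proj φ)) ^ 2).trace = (4 * (d * star d)) ^ 2 := by
    rw [← htr, proj, Matrix.vecMulVec_mul, pow_two, Matrix.vecMulVec_mul_vecMulVec]
    simp [Matrix.trace_vecMulVec, pow_two, dotProduct_comm]
  have hpt : (ptraceRight (proj φ)).det = d * star d := by
    rw [Matrix.det_fin_two]
    simp [ptraceRight, proj, Matrix.vecMulVec_apply, hd]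
    ring
  have hn : d * star d = ((‖d‖ ^ 2 : ℝ) : ℂ) := by
    simpa using Complex.mul_conj' d
  rw [harmony, hdet, htr, hsq, hpt, hn]
  have : (2 * (4 * ((‖d‖ ^ 2 : ℝ) : ℂ)) ^ 2 - (4 * ((‖d‖ ^ 2 : ℝ) : ℂ)) ^ 2 - 8 * 0)
      = (((4 * ‖d‖ ^ 2) ^ 2 : ℝ) : ℂ) := by
    push_cast; ring
  rw [this, Complex.ofReal_re, Complex.ofReal_re, max_eq_right (by positivity)]

theorem IsEffective.ptraceRight_eq {ψ : Q3 → ℂ} {φ : Q2 → ℂ} (h : IsEffective ψ φ) :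
    ptraceRight (proj φ) = ptraceRight (proj ψ) := by
  obtain ⟨V, hV, rfl⟩ := h
  ext x x'
  have hV' : ∀ w w', ∑ u, star (V u w) * V u w' = (1 : Matrix Q1 Q1 ℂ) w w' := by
    intro w w'
    rw [← hV, Matrix.mul_apply]
    rfl
  simp only [ptraceRight, proj, Matrix.of_apply, Matrix.vecMulVec_apply, Pi.star_apply,
    isEffective_apply, Fin.sum_univ_two, star_add, star_mul']
  have h00 := hV' 0 0
  have h01 := hV' 0 1
  have h10 := hV' 1 0
  have h11 := hV' 1 1
  simp only [Fintype.sum_prod_type, Fin.sum_univ_two, Matrix.one_apply] at h00 h01 h10 h11 ⊢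
  simp at h00 h01 h10 h11 ⊢
  linear_combination (-φ (x, 0) * (starRingEnd ℂ) (φ (x', 0))) * h00
    + (-φ (x, 1) * (starRingEnd ℂ) (φ (x', 0))) * h01
    + (-φ (x, 0) * (starRingEnd ℂ) (φ (x', 1))) * h10
    + (-φ (x, 1) * (starRingEnd ℂ) (φ (x', 1))) * h11

/-- `H_{X(YZ)}` of a pure three-qubit state: the harmony between `X` and
the effective qubit carried by the pair `YZ`. -/
noncomputable def harmonyX_YZ (ψ : Q3 → ℂ) : ℝ :=
  harmony (proj (exists_isEffective ψ).choose)

theorem harmonyX_YZ_eq (ψ : Q3 → ℂ) :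
    harmonyX_YZ ψ = (4 * (ptraceRight (proj ψ)).det.re) ^ 2 := by
  rw [harmonyX_YZ, harmony_proj, (exists_isEffective ψ).choose_spec.ptraceRight_eq]

/-- `harmonyX_YZ` does not depend on the choice of the effective qubit. -/
theorem IsEffective.harmony_eq {ψ : Q3 → ℂ} {φ : Q2 → ℂ} (h : IsEffective ψ φ) :
    harmony (proj φ) = harmonyX_YZ ψ := by
  rw [harmonyX_YZ_eq, harmony_proj, h.ptraceRight_eq]

/-- `ρ = ∑ i, p i |ψ i⟩⟨ψ i|` is a decomposition of `ρ` into `K` pure states. -/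
structure IsPureDecomposition (ρ : Matrix Q3 Q3 ℂ) (K : ℕ) (p : Fin K → ℝ)
    (ψ : Fin K → Q3 → ℂ) : Prop where
  nonneg : ∀ i, 0 ≤ p i
  sum_eq_one : ∑ i, p i = 1
  unit : ∀ i, IsUnitVec (ψ i)
  eq_sum : ρ = ∑ i, (p i : ℂ) • proj (ψ i)

/-- The averages of `H_{X(YZ)} ^ (1/2)` over all pure state decompositions of `ρ`. -/
def sqrtHarmonyAverages (ρ : Matrix Q3 Q3 ℂ) : Set ℝ :=
  {v | ∃ (K : ℕ) (p : Fin K → ℝ) (ψ : Fin K → Q3 → ℂ),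
    IsPureDecomposition ρ K p ψ ∧ v = ∑ i, p i * √(harmonyX_YZ (ψ i))}

/-- `(H^{1/2})_{X(YZ)}^{min}`. -/
noncomputable def sqrtHarmonyMin (ρ : Matrix Q3 Q3 ℂ) : ℝ :=
  sInf (sqrtHarmonyAverages ρ)

end Harmony

/-! Write a two-qubit state as `ρ = B * Bᴴ` and set `τ = Bᵀ * sigmaYY * B`. A Takagi basis makes `τ`
diagonal with entries `d i ≥ 0` (Wootters' numbers), and the polynomial in the harmony becomes minus
the product of the four factors `∑ d - 2 d i`. If it is positive, some factor is negative. That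
factor is bounded in absolute value by the average concurrence `∑ ‖τ k k‖` of any ensemble, and the
others by `tr ρ = 1`. Hence `harmony_le_sum_norm`.

Each pure component of a three-qubit mixture leaves a rank-two operator on `XY`. It splits into two
vectors, one of zero concurrence, so its squared average concurrence is at most `tr (ρ ρ̃)`.
Convexity of the square gives `harmony_sq_le_sum`. For pure states the two traces, for `XY` and
`XZ`, add up to `4 det ρ_X` (`sum_norm_sq_add_sum_norm_sq`), which is the summand being averaged.

The minimum is attained because the averages form a slice of the convex hull of a compact graph. -/

namespace Harmony

/-! ### Takagi factorization through antilinear symmetric maps. -/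

section Takagi

variable {E : Type*} [NormedAddCommGroup E] [InnerProductSpace ℂ E] [FiniteDimensional ℂ E]

/-- A symmetric conjugate-linear map has a unit vector with `J v = c v`, `c ≥ 0`, in every
nonzero invariant subspace. -/
theorem exists_unit_eigenvector_of_antilinear (J : E →ₛₗ[starRingEnd ℂ] E)
    (hJ : ∀ x y, inner ℂ (J x) y = inner ℂ (J y) x) (p : Submodule ℂ E)
    (hp : ∀ x ∈ p, J x ∈ p) (hp0 : p ≠ ⊥) :
    ∃ v ∈ p, ‖v‖ = 1 ∧ ∃ c : ℝ, 0 ≤ c ∧ J v = (c : ℂ) • v := by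
  suffices h : ∃ v ∈ p, v ≠ 0 ∧ ∃ c : ℝ, 0 ≤ c ∧ J v = (c : ℂ) • v by
    obtain ⟨v, hv, hv0, c, hc, hJv⟩ := h
    refine ⟨((‖v‖⁻¹ : ℝ) : ℂ) • v, p.smul_mem _ hv, ?_, c, hc, ?_⟩
    · rw [norm_smul, Complex.norm_real, norm_inv, norm_norm, inv_mul_cancel₀ (norm_ne_zero_iff.2 hv0)]
    · rw [map_smulₛₗ, Complex.conj_ofReal, hJv, smul_comm]
  let T : E →ₗ[ℂ] E := J.comp J
  have hT : ∀ x ∈ p, T x ∈ p := fun x hx => hp _ (hp _ hx)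
  have : Nontrivial p := Submodule.nontrivial_iff_ne_bot.2 hp0
  obtain ⟨a, ha⟩ := Module.End.exists_eigenvalue (T.restrict hT)
  obtain ⟨⟨x, hxp⟩, hx, hx0⟩ := ha.exists_hasEigenvector
  have hx0 : x ≠ 0 := fun h => hx0 (by simp [h])
  have hTx : J (J x) = a • x := by
    have := Module.End.mem_eigenspace_iff.1 hx
    exact congrArg Subtype.val this
  have hnx : 0 < ‖x‖ := norm_pos_iff.2 hx0
  -- Symmetry of `J` forces the eigenvalue `a` of `J ∘ J` to be real and nonnegative, hence a square
  -- `c * c`.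
  have hin : starRingEnd ℂ a * ((‖x‖ ^ 2 : ℝ) : ℂ) = ((‖J x‖ ^ 2 : ℝ) : ℂ) := by
    have h := hJ (J x) x
    rw [hTx, inner_smul_left, inner_self_eq_norm_sq_to_K, inner_self_eq_norm_sq_to_K] at h
    simpa using h
  set c : ℝ := ‖J x‖ / ‖x‖ with hc
  have hac : a = (c : ℂ) * c := by
    have hne : ((‖x‖ : ℝ) : ℂ) ≠ 0 := by exact_mod_cast hnx.ne'
    have : starRingEnd ℂ a = (c : ℂ) * c := by
      rw [hc]; push_cast at hin ⊢
      field_simp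
      linear_combination hin
    rw [← Complex.conj_conj a, this]; simp
  have hc0 : 0 ≤ c := by positivity
  -- As `J (J x) = c² x`, the vector `J x + c x` has eigenvalue `c` unless it vanishes. In that case
  -- `J x = -c x`, and antilinearity flips the sign on `I • x`.
  by_cases h0 : J x + (c : ℂ) • x = 0
  · refine ⟨Complex.I • x, p.smul_mem _ hxp, smul_ne_zero Complex.I_ne_zero hx0, c, hc0, ?_⟩
    rw [map_smulₛₗ, eq_neg_of_add_eq_zero_left h0, Complex.conj_I, smul_neg, neg_smul, neg_neg,
      smul_comm]
  · refine ⟨_, p.add_mem (hp _ hxp) (p.smul_mem _ hxp), h0, c, hc0, ?_⟩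
    rw [map_add, map_smulₛₗ, Complex.conj_ofReal, hTx, hac, smul_add, smul_smul, add_comm]

/-- Split off one eigenvector `v`: by symmetry `⟨J x, v⟩ = ⟨J v, x⟩ = c ⟨v, x⟩`, so its orthogonal
complement in `p` is again invariant. -/
theorem exists_orthonormal_eigenvectors_of_antilinear (J : E →ₛₗ[starRingEnd ℂ] E)
    (hJ : ∀ x y, inner ℂ (J x) y = inner ℂ (J y) x) (n : ℕ) (p : Submodule ℂ E)
    (hp : ∀ x ∈ p, J x ∈ p) (hn : Module.finrank ℂ p = n) :
    ∃ (e : Fin n → E) (d : Fin n → ℝ), Orthonormal ℂ e ∧ (∀ i, e i ∈ p) ∧ (∀ i, 0 ≤ d i) ∧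
      ∀ i, J (e i) = (d i : ℂ) • e i := by
  induction n generalizing p with
  | zero => exact ⟨Fin.elim0, Fin.elim0, ⟨fun i => i.elim0, fun i => i.elim0⟩,
      fun i => i.elim0, fun i => i.elim0, fun i => i.elim0⟩
  | succ n ih =>
    have hp0 : p ≠ ⊥ := by rintro rfl; simp at hn
    obtain ⟨v, hv, hv1, c, hc, hJv⟩ := exists_unit_eigenvector_of_antilinear J hJ p hp hp0
    have hv0 : v ≠ 0 := by rintro rfl; simp at hv1
    have hle : Submodule.span ℂ {v} ≤ p := (Submodule.span_singleton_le_iff_mem _ _).2 hv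
    have hfr := Submodule.finrank_add_inf_finrank_orthogonal hle
    rw [finrank_span_singleton hv0, hn] at hfr
    obtain ⟨e, d, he, hep, hd, hJe⟩ := ih ((Submodule.span ℂ {v})ᗮ ⊓ p) (by
      rintro x ⟨hx, hxp⟩
      refine ⟨?_, hp x hxp⟩
      rw [SetLike.mem_coe, Submodule.mem_orthogonal_singleton_iff_inner_left] at hx ⊢
      rw [hJ, hJv, inner_smul_left, inner_eq_zero_symm.1 hx, mul_zero]) (by omega)
    refine ⟨Fin.cons v e, Fin.cons c d, ?_, ?_, ?_, ?_⟩
    · refine orthonormal_vecCons_iff.2 ⟨hv1, fun i => ?_, he⟩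
      exact Submodule.mem_orthogonal_singleton_iff_inner_right.1 (hep i).1
    · exact fun i => Fin.cases hv (fun j => (hep j).2) i
    · exact fun i => Fin.cases hc hd i
    · exact fun i => Fin.cases hJv hJe i

/-- Takagi factorization of a complex symmetric matrix. -/
theorem exists_takagi {n : Type*} [Fintype n] [DecidableEq n] (S : Matrix n n ℂ) (hS : Sᵀ = S) :
    ∃ (U : Matrix n n ℂ) (d : n → ℝ), Uᴴ * U = 1 ∧ (∀ i, 0 ≤ d i) ∧
      Uᵀ * S * U = Matrix.diagonal fun i => (d i : ℂ) := by
  -- With `J x` the conjugate of `S x`, one has `⟨J x, y⟩ = yᵀ S x`, so symmetry of `S` is exactly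
  -- symmetry of `J`.
  let J : EuclideanSpace ℂ n →ₛₗ[starRingEnd ℂ] EuclideanSpace ℂ n :=
    { toFun := fun x => WithLp.toLp 2 (star (S *ᵥ x.ofLp))
      map_add' := fun x y => by
        ext i; simp [Matrix.mulVec_add]
      map_smul' := fun c x => by
        ext i; simp [Matrix.mulVec_smul] }
  have hJi : ∀ x y, inner ℂ (J x) y = y.ofLp ⬝ᵥ S *ᵥ x.ofLp := by
    intro x y
    rw [EuclideanSpace.inner_eq_star_dotProduct]
    simp [J]
  have hJ : ∀ x y, inner ℂ (J x) y = inner ℂ (J y) x := by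
    intro x y
    rw [hJi, hJi, Matrix.dotProduct_mulVec, ← Matrix.mulVec_transpose, hS, dotProduct_comm]
  obtain ⟨e, d, he, -, hd, hJe⟩ := exists_orthonormal_eigenvectors_of_antilinear J hJ
    (Fintype.card n) ⊤ (fun _ _ => trivial) (by simp)
  let f := Fintype.equivFin n
  refine ⟨Matrix.of fun i j => e (f j) i, fun i => d (f i), ?_, fun i => hd _, ?_⟩
  · ext i j
    have h := orthonormal_iff_ite.1 he (f i) (f j)
    rw [EuclideanSpace.inner_eq_star_dotProduct, dotProduct_comm] at h
    simpa [Matrix.mul_apply, Matrix.one_apply, dotProduct] using h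
  · ext i j
    have h1 := hJi (e (f j)) (e (f i))
    rw [hJe, inner_smul_left, orthonormal_iff_ite.1 he, Complex.conj_ofReal] at h1
    rw [Matrix.mul_assoc, Matrix.mul_apply, Matrix.diagonal_apply]
    trans (e (f i)).ofLp ⬝ᵥ S *ᵥ (e (f j)).ofLp
    · simp [dotProduct, Matrix.mulVec, Matrix.mul_apply]
    · rw [← h1]
      by_cases hij : i = j
      · simp [hij]
      · simp [hij, Ne.symm hij]

end Takagi

/-! ### Harmony in terms of Wootters' numbers. -/

/-- The matrix `σ_y ⊗ σ_y`. -/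
noncomputable def sigmaYY : Matrix Q2 Q2 ℂ := sigmaY ⊗ₖ sigmaY

theorem sigmaYY_transpose : sigmaYYᵀ = sigmaYY := by
  ext ⟨a, b⟩ ⟨c, d⟩
  fin_cases a <;> fin_cases b <;> fin_cases c <;> fin_cases d <;> simp [sigmaYY, sigmaY]

theorem sigmaYY_conjTranspose : sigmaYYᴴ = sigmaYY := by
  ext ⟨a, b⟩ ⟨c, d⟩
  fin_cases a <;> fin_cases b <;> fin_cases c <;> fin_cases d <;> simp [sigmaYY, sigmaY]

theorem sigmaYY_diag (a : Q2) : sigmaYY a a = 0 := by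
  obtain ⟨a, b⟩ := a
  fin_cases a <;> fin_cases b <;> simp [sigmaYY, sigmaY]

theorem det_sigmaYY : sigmaYY.det = 1 := by
  rw [sigmaYY, Matrix.det_kronecker]
  simp [sigmaY]

theorem norm_sigmaYY_quadratic_le (w : Q2 → ℂ) : ‖w ⬝ᵥ sigmaYY *ᵥ w‖ ≤ ∑ a, ‖w a‖ ^ 2 := by
  have h : w ⬝ᵥ sigmaYY *ᵥ w = 2 * (w (0, 1) * w (1, 0)) - 2 * (w (0, 0) * w (1, 1)) := by
    simp [dotProduct, Matrix.mulVec, sigmaYY, sigmaY, Fintype.sum_prod_type]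
    ring
  rw [h]
  refine (norm_sub_le _ _).trans ?_
  simp only [norm_mul, Complex.norm_ofNat, Fintype.sum_prod_type, Fin.sum_univ_two]
  nlinarith [sq_nonneg (‖w (0, 1)‖ - ‖w (1, 0)‖), sq_nonneg (‖w (0, 0)‖ - ‖w (1, 1)‖)]

theorem spinFlip_mul_conjTranspose {κ : Type*} [Fintype κ] (W : Matrix Q2 κ ℂ) :
    spinFlip (W * Wᴴ) = sigmaYY * (W * Wᴴ)ᵀ * sigmaYY := by
  have h : (W * Wᴴ).map (starRingEnd ℂ) = (W * Wᴴ)ᵀ := by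
    ext i j
    simp [Matrix.mul_apply, mul_comm]
  rw [spinFlip, h, sigmaYY]

/-- The quantity whose positive part is the harmony. -/
noncomputable def harmonyPoly (ρ : Matrix Q2 Q2 ℂ) : ℝ :=
  (2 * ((ρ * spinFlip ρ) ^ 2).trace - (ρ * spinFlip ρ).trace ^ 2 - 8 * ρ.det).re

/-- This form lets cyclicity of the trace replace `ρ ρ̃` by `τᴴ * τ` with `τ = Wᵀ * sigmaYY * W`. -/
theorem mul_spinFlip_eq {κ : Type*} [Fintype κ] (W : Matrix Q2 κ ℂ) :
    W * Wᴴ * spinFlip (W * Wᴴ) = W * ((Wᵀ * sigmaYY * W)ᴴ * Wᵀ * sigmaYY) := by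
  rw [spinFlip_mul_conjTranspose]
  simp only [Matrix.conjTranspose_mul, sigmaYY_conjTranspose, Matrix.transpose_mul,
    Matrix.mul_assoc]
  rfl

theorem trace_mul_spinFlip {κ : Type*} [Fintype κ] (W : Matrix Q2 κ ℂ) :
    (W * Wᴴ * spinFlip (W * Wᴴ)).trace
      = ((Wᵀ * sigmaYY * W)ᴴ * (Wᵀ * sigmaYY * W)).trace := by
  rw [mul_spinFlip_eq, Matrix.trace_mul_comm]
  simp only [Matrix.mul_assoc]

theorem trace_mul_spinFlip_sq {κ : Type*} [Fintype κ] [DecidableEq κ] (W : Matrix Q2 κ ℂ) :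
    ((W * Wᴴ * spinFlip (W * Wᴴ)) ^ 2).trace
      = (((Wᵀ * sigmaYY * W)ᴴ * (Wᵀ * sigmaYY * W)) ^ 2).trace := by
  rw [mul_spinFlip_eq, pow_two, Matrix.mul_assoc, Matrix.trace_mul_comm, pow_two]
  simp only [Matrix.mul_assoc]

/-- The four-fold product with `harmony = max 0 (-product)`. -/
theorem harmonyPoly_eq_neg_prod (W : Matrix Q2 Q2 ℂ) (d : Q2 → ℝ) (hd : ∀ i, 0 ≤ d i)
    (h : Wᵀ * sigmaYY * W = Matrix.diagonal fun i => (d i : ℂ)) :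
    harmonyPoly (W * Wᴴ) = -∏ i, (∑ j, d j - 2 * d i) := by
  have hdet : (W * Wᴴ).det = ((∏ i, d i : ℝ) : ℂ) := by
    have h1 := congrArg Matrix.det h
    rw [Matrix.det_mul, Matrix.det_mul, Matrix.det_transpose, det_sigmaYY, Matrix.det_diagonal,
      mul_one, ← Complex.ofReal_prod] at h1
    rw [Matrix.det_mul, Matrix.det_conjTranspose]
    have h2 := congrArg norm h1
    rw [norm_mul, Complex.norm_real, Real.norm_of_nonneg (Finset.prod_nonneg fun i _ => hd i)] at h2
    rw [← h2]
    simpa [pow_two] using Complex.mul_conj' W.det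
  rw [harmonyPoly, trace_mul_spinFlip_sq, trace_mul_spinFlip, h, hdet,
    Matrix.diagonal_conjTranspose, Matrix.diagonal_mul_diagonal, Matrix.diagonal_pow,
    Matrix.trace_diagonal, Matrix.trace_diagonal]
  have : (2 * ∑ i, ((fun i => star (fun i => (d i : ℂ)) i * (d i : ℂ)) ^ 2) i
      - (∑ i, star (fun i => (d i : ℂ)) i * (d i : ℂ)) ^ 2 - 8 * ((∏ i, d i : ℝ) : ℂ))
      = ((2 * ∑ i, d i ^ 4 - (∑ i, d i ^ 2) ^ 2 - 8 * ∏ i, d i : ℝ) : ℂ) := by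
    push_cast
    simp only [Pi.pow_apply, Pi.star_apply, RCLike.star_def, Complex.conj_ofReal]
    simp only [← pow_two, ← pow_mul]
    norm_num
  rw [this, Complex.ofReal_re]
  -- What remains is the expansion of Brahmagupta's product in four variables.
  simp only [Fintype.sum_prod_type, Fintype.prod_prod_type, Fin.sum_univ_two, Fin.prod_univ_two]
  ring

/-! ### Harmony is bounded by average concurrence. -/

theorem two_mul_sub_sum_le_sum_norm_diag {κ ι : Type*} [Fintype κ] [Fintype ι] [DecidableEq ι]
    (V : Matrix ι κ ℂ) (hV : V * Vᴴ = 1) (d : ι → ℝ) (hd : ∀ i, 0 ≤ d i) (i : ι) :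
    2 * d i - ∑ j, d j ≤
      ∑ k, ‖(Vᵀ * Matrix.diagonal (fun i => (d i : ℂ)) * V) k k‖ := by
  have hrow : ∀ j, ∑ k, ‖V j k‖ ^ 2 = 1 := by
    intro j
    have h := congrFun (congrFun hV j) j
    rw [Matrix.mul_apply, Matrix.one_apply_eq] at h
    simp only [Matrix.conjTranspose_apply, RCLike.star_def, Complex.mul_conj'] at h
    exact_mod_cast h
  -- The diagonal entry is `∑ d j * V j k ^ 2`; the reverse triangle inequality isolates the term
  -- `i`. Summing over `k` uses that the rows of `V` are unit vectors.
  have hk : ∀ k, 2 * (d i * ‖V i k‖ ^ 2) - ∑ j, d j * ‖V j k‖ ^ 2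
      ≤ ‖(Vᵀ * Matrix.diagonal (fun i => (d i : ℂ)) * V) k k‖ := by
    intro k
    have h1 : (Vᵀ * Matrix.diagonal (fun i => (d i : ℂ)) * V) k k = ∑ j, (d j : ℂ) * V j k ^ 2 := by
      rw [Matrix.mul_apply]
      exact Finset.sum_congr rfl fun j _ => by
        rw [Matrix.mul_diagonal, Matrix.transpose_apply]; ring
    have hn : ∀ j, ‖(d j : ℂ) * V j k ^ 2‖ = d j * ‖V j k‖ ^ 2 := fun j => by
      rw [norm_mul, norm_pow, Complex.norm_real, Real.norm_of_nonneg (hd j)]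
    rw [h1, ← Finset.add_sum_erase _ _ (Finset.mem_univ i), ← Finset.add_sum_erase _
      (fun j => (d j : ℂ) * V j k ^ 2) (Finset.mem_univ i)]
    have h2 := norm_sub_le_norm_add ((d i : ℂ) * V i k ^ 2)
      (∑ j ∈ Finset.univ.erase i, (d j : ℂ) * V j k ^ 2)
    have h3 := norm_sum_le (Finset.univ.erase i) fun j => (d j : ℂ) * V j k ^ 2
    simp only [hn] at h2 h3
    linarith
  refine le_trans (le_of_eq ?_) (Finset.sum_le_sum fun k _ => hk k)
  rw [Finset.sum_sub_distrib, Finset.sum_comm, ← Finset.mul_sum, ← Finset.mul_sum, hrow, mul_one]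
  simp only [← Finset.mul_sum, hrow, mul_one]

/-- If no factor is negative, the left side is at most zero. Otherwise one negative factor has
absolute value at most `c`, and every other lies in `[-t, t]` because `0 ≤ d j ≤ ∑ d ≤ t`. -/
theorem neg_prod_le {ι : Type*} [Fintype ι] [DecidableEq ι] (d : ι → ℝ) (hd : ∀ i, 0 ≤ d i)
    {t c : ℝ} (ht : ∑ i, d i ≤ t) (hc : 0 ≤ c) (h : ∀ i, 2 * d i - ∑ j, d j ≤ c) :
    -∏ i, (∑ j, d j - 2 * d i) ≤ t ^ (Fintype.card ι - 1) * c := by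
  have hs : 0 ≤ ∑ i, d i := Finset.sum_nonneg fun i _ => hd i
  have h0 : 0 ≤ t := hs.trans ht
  by_cases hneg : ∀ i, 0 ≤ ∑ j, d j - 2 * d i
  · have := Finset.prod_nonneg fun i (_ : i ∈ Finset.univ) => hneg i
    have : 0 ≤ t ^ (Fintype.card ι - 1) * c := by positivity
    linarith
  · push Not at hneg
    obtain ⟨i, hi⟩ := hneg
    refine (neg_le_abs _).trans ?_
    rw [Finset.abs_prod, ← Finset.mul_prod_erase _ _ (Finset.mem_univ i), mul_comm]
    have hle : ∏ j ∈ Finset.univ.erase i, |∑ l, d l - 2 * d j| ≤ t ^ (Fintype.card ι - 1) := by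
      rw [← Finset.card_univ, ← Finset.card_erase_of_mem (Finset.mem_univ i),
        ← Finset.prod_const]
      refine Finset.prod_le_prod (fun j _ => abs_nonneg _) fun j _ => ?_
      have := Finset.single_le_sum (fun l _ => hd l) (Finset.mem_univ j)
      rw [abs_le]
      constructor <;> linarith [hd j]
    refine mul_le_mul hle ?_ (abs_nonneg _) (by positivity)
    rw [abs_of_neg hi]
    linarith [h i]

open scoped MatrixOrder in
theorem _root_.Matrix.PosSemidef.exists_eq_conjTranspose_mul_self {n : Type*} [Fintype n]
    [DecidableEq n] {A : Matrix n n ℂ} (hA : A.PosSemidef) : ∃ C : Matrix n n ℂ, A = Cᴴ * C :=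
  CStarAlgebra.nonneg_iff_eq_star_mul_self.1 (Matrix.nonneg_iff_posSemidef.2 hA)

/-- Definiteness makes the Takagi factor `W` invertible, so any other factor is `B = W * V` with `V
* Vᴴ = 1`. The exponent 3 counts the remaining factors of the product. -/
theorem harmonyPoly_le_of_posDef {κ : Type*} [Fintype κ] (B : Matrix Q2 κ ℂ)
    (hB : (B * Bᴴ).PosDef) :
    harmonyPoly (B * Bᴴ) ≤
      (B * Bᴴ).trace.re ^ 3 * ∑ k, ‖(Bᵀ * sigmaYY * B) k k‖ := by
  obtain ⟨C, hC⟩ := hB.posSemidef.exists_eq_conjTranspose_mul_self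
  obtain ⟨U, d, hU, hd, hUd⟩ := exists_takagi (Cᴴᵀ * sigmaYY * Cᴴ) (by
    simp only [Matrix.transpose_mul, Matrix.transpose_transpose, sigmaYY_transpose,
      Matrix.mul_assoc])
  have hU' : U * Uᴴ = 1 := mul_eq_one_comm.1 hU
  set W := Cᴴ * U with hW
  have hWW : W * Wᴴ = B * Bᴴ := by
    rw [hW, Matrix.conjTranspose_mul, Matrix.mul_assoc, ← Matrix.mul_assoc U, hU', Matrix.one_mul,
      Matrix.conjTranspose_conjTranspose, hC]
  have hWd : Wᵀ * sigmaYY * W = Matrix.diagonal fun i => (d i : ℂ) := by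
    rw [← hUd, hW, Matrix.transpose_mul]
    simp only [Matrix.mul_assoc]
  have hWdet : IsUnit W.det := by
    have := hB.det_pos.ne'
    rw [← hWW, Matrix.det_mul] at this
    exact (left_ne_zero_of_mul this).isUnit
  set V := W⁻¹ * B with hV
  have hBV : B = W * V := by rw [hV, Matrix.mul_nonsing_inv_cancel_left _ _ hWdet]
  have hVV : V * Vᴴ = 1 := by
    have hWH : IsUnit Wᴴ.det := by rw [Matrix.det_conjTranspose]; exact hWdet.star
    rw [hV, Matrix.conjTranspose_mul, Matrix.mul_assoc, ← Matrix.mul_assoc B, ← hWW,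
      Matrix.conjTranspose_nonsing_inv, Matrix.mul_assoc, Matrix.mul_nonsing_inv _ hWH,
      Matrix.mul_one, Matrix.nonsing_inv_mul _ hWdet]
  have hBd : Bᵀ * sigmaYY * B = Vᵀ * Matrix.diagonal (fun i => (d i : ℂ)) * V := by
    rw [← hWd, hBV, Matrix.transpose_mul]
    simp only [Matrix.mul_assoc]
  have htr : ∑ i, d i ≤ (B * Bᴴ).trace.re := by
    rw [← hWW, Matrix.trace_mul_comm, Matrix.trace, Complex.re_sum]
    refine Finset.sum_le_sum fun i _ => ?_
    have h1 : (Wᴴ * W) i i = ((∑ a, ‖W a i‖ ^ 2 : ℝ) : ℂ) := by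
      rw [Matrix.mul_apply]
      push_cast
      exact Finset.sum_congr rfl fun a _ => by
        rw [Matrix.conjTranspose_apply]; exact Complex.conj_mul' _
    have h2 : (d i : ℂ) = Wᵀ i ⬝ᵥ sigmaYY *ᵥ Wᵀ i := by
      have := congrFun (congrFun hWd i) i
      rw [Matrix.diagonal_apply_eq, Matrix.mul_assoc] at this
      rw [← this]
      simp [Matrix.mul_apply, dotProduct, Matrix.mulVec]
    have h3 := norm_sigmaYY_quadratic_le (Wᵀ i)
    rw [← h2, Complex.norm_real, Real.norm_of_nonneg (hd i)] at h3
    rw [Matrix.diag_apply, h1, Complex.ofReal_re]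
    exact h3
  have key := neg_prod_le d hd htr (Finset.sum_nonneg fun k _ => norm_nonneg _)
    (fun i => two_mul_sub_sum_le_sum_norm_diag V hVV d hd i)
  rw [hBd, ← hWW, harmonyPoly_eq_neg_prod W d hd hWd, hWW]
  exact key

theorem continuous_harmonyPoly : Continuous harmonyPoly := by
  have h1 : Continuous spinFlip :=
    (continuous_const.matrix_mul (continuous_id.matrix_map Complex.continuous_conj)).matrix_mul
      continuous_const
  have h2 : Continuous fun ρ : Matrix Q2 Q2 ℂ => ρ * spinFlip ρ := continuous_id.matrix_mul h1
  exact Complex.continuous_re.comp (((continuous_const.mul (h2.pow 2).matrix_trace).sub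
    (h2.matrix_trace.pow 2)).sub (continuous_const.mul continuous_id.matrix_det))

/-- The harmony is at most the average concurrence of any ensemble realizing the state. -/
theorem harmony_le_sum_norm {κ : Type*} [Fintype κ] (B : Matrix Q2 κ ℂ)
    (hB : (B * Bᴴ).trace = 1) :
    harmony (B * Bᴴ) ≤ ∑ k, ‖(Bᵀ * sigmaYY * B) k k‖ := by
  refine max_le (Finset.sum_nonneg fun k _ => norm_nonneg _) ?_
  change harmonyPoly _ ≤ _
  have key : ∀ ε : ℝ, 0 < ε → harmonyPoly (B * Bᴴ + ((ε ^ 2 : ℝ) : ℂ) • 1) ≤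
      (B * Bᴴ + ((ε ^ 2 : ℝ) : ℂ) • (1 : Matrix Q2 Q2 ℂ)).trace.re ^ 3 *
        ∑ k, ‖(Bᵀ * sigmaYY * B) k k‖ := by
    intro ε hε
    -- The added columns are multiples of product basis vectors: they make the state definite but
    -- contribute no concurrence. The bound then follows as `ε → 0`.
    let B' : Matrix Q2 (κ ⊕ Q2) ℂ := Matrix.fromCols B ((ε : ℂ) • 1)
    have h1 : B' * B'ᴴ = B * Bᴴ + ((ε ^ 2 : ℝ) : ℂ) • 1 := by
      simp only [B', Matrix.conjTranspose_fromCols_eq_fromRows_conjTranspose,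
        Matrix.fromCols_mul_fromRows]
      ext i j
      simp [pow_two, mul_assoc]
    have h2 : ∑ k, ‖(B'ᵀ * sigmaYY * B') k k‖ = ∑ k, ‖(Bᵀ * sigmaYY * B) k k‖ := by
      simp only [B', Matrix.transpose_fromCols, Matrix.fromRows_mul,
        Fintype.sum_sum_type]
      simp [sigmaYY_diag]
    have hpd : (B' * B'ᴴ).PosDef := by
      rw [h1]
      refine Matrix.PosDef.posSemidef_add (Matrix.posSemidef_self_mul_conjTranspose B) ?_
      refine Matrix.PosDef.one.smul ?_
      exact_mod_cast pow_pos hε 2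
    have h3 := harmonyPoly_le_of_posDef B' hpd
    rwa [h1, h2] at h3
  have hc : Continuous fun ε : ℝ => B * Bᴴ + ((ε ^ 2 : ℝ) : ℂ) • (1 : Matrix Q2 Q2 ℂ) := by
    fun_prop
  have hl := ((continuous_harmonyPoly.comp hc).tendsto 0).mono_left
    (nhdsWithin_le_nhds (s := Set.Ioi (0 : ℝ)))
  have hr := ((((Complex.continuous_re.comp hc.matrix_trace).pow 3).mul_const
    (∑ k, ‖(Bᵀ * sigmaYY * B) k k‖)).tendsto 0).mono_left
    (nhdsWithin_le_nhds (s := Set.Ioi (0 : ℝ)))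
  have := le_of_tendsto_of_tendsto hl hr (by
    filter_upwards [self_mem_nhdsWithin] with ε hε using key ε hε)
  simpa [hB] using this

/-! ### Rank-two operators and their mixtures. -/

theorem _root_.Complex.exists_unit_quadratic_form_eq_zero (a b c : ℂ) :
    ∃ x y : ℂ, ‖x‖ ^ 2 + ‖y‖ ^ 2 = 1 ∧ a * x ^ 2 + 2 * b * (x * y) + c * y ^ 2 = 0 := by
  by_cases ha : a = 0
  · exact ⟨1, 0, by simp, by simp [ha]⟩
  obtain ⟨z, hz⟩ := exists_quadratic_eq_zero (b := 2 * b) (c := c) ha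
    (IsAlgClosed.exists_eq_mul_self _)
  set r : ℝ := √(‖z‖ ^ 2 + 1) with hr
  have hr2 : r ^ 2 = ‖z‖ ^ 2 + 1 := Real.sq_sqrt (by positivity)
  have hr0 : 0 < r := Real.sqrt_pos.2 (by positivity)
  have hrc : (r : ℂ) ≠ 0 := by exact_mod_cast hr0.ne'
  refine ⟨z / r, 1 / r, ?_, ?_⟩
  · rw [norm_div, norm_div, Complex.norm_real, Real.norm_of_nonneg hr0.le, norm_one]
    field_simp
    linarith
  · field_simp
    linear_combination hz

theorem trace_conjTranspose_mul_self_eq_sum {m n : Type*} [Fintype m] [Fintype n]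
    (S : Matrix m n ℂ) : (Sᴴ * S).trace = ((∑ k, ∑ l, ‖S k l‖ ^ 2 : ℝ) : ℂ) := by
  simp only [Matrix.trace, Matrix.diag_apply, Matrix.mul_apply, Matrix.conjTranspose_apply]
  rw [Finset.sum_comm]
  push_cast
  exact Finset.sum_congr rfl fun _ _ => Finset.sum_congr rfl fun _ _ => Complex.conj_mul' _

/-- A rank-two two-qubit operator has an ensemble of two vectors, one of which is a product vector;
the concurrence of the other is bounded by the trace of `ρ ρ̃`. -/
theorem exists_two_column_ensemble (A : Matrix Q2 Q1 ℂ) :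
    ∃ b : Matrix Q2 Q1 ℂ, b * bᴴ = A * Aᴴ ∧
      (∑ k, ‖(bᵀ * sigmaYY * b) k k‖) ^ 2 ≤ ∑ k, ∑ l, ‖(Aᵀ * sigmaYY * A) k l‖ ^ 2 := by
  set S := Aᵀ * sigmaYY * A with hS
  have hST : S 1 0 = S 0 1 := by
    have h : Sᵀ = S := by
      simp only [hS, Matrix.transpose_mul, Matrix.transpose_transpose, sigmaYY_transpose,
        Matrix.mul_assoc]
    exact congrFun (congrFun h 0) 1
  obtain ⟨x, y, hxy, h0⟩ :=
    Complex.exists_unit_quadratic_form_eq_zero (S 0 0) (S 0 1) (S 1 1)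
  -- The unitary completion of the isotropic vector `(x, y)`: congruence by it kills the entry `0 0`
  -- and preserves the Frobenius norm.
  let U : Matrix Q1 Q1 ℂ := !![x, -star y; y, star x]
  have hxy' : starRingEnd ℂ x * x + starRingEnd ℂ y * y = 1 := by
    rw [Complex.conj_mul', Complex.conj_mul']
    exact_mod_cast hxy
  have hU : Uᴴ * U = 1 := by
    ext i j
    fin_cases i <;> fin_cases j <;> simp [U, Matrix.mul_apply, Fin.sum_univ_two]
    · linear_combination hxy'
    · ring
    · ring
    · linear_combination hxy'
  have hU' : U * Uᴴ = 1 := mul_eq_one_comm.1 hU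
  have hU'' : Uᴴᵀ * Uᵀ = 1 := by rw [← Matrix.transpose_mul, hU', Matrix.transpose_one]
  have hT : (A * U)ᵀ * sigmaYY * (A * U) = Uᵀ * S * U := by
    simp only [hS, Matrix.transpose_mul, Matrix.mul_assoc]
  have h00 : (Uᵀ * S * U) 0 0 = 0 := by
    simp only [Matrix.mul_apply, Fin.sum_univ_two, Matrix.transpose_apply, hST]
    simp [U]
    linear_combination h0
  have hF : ∑ k, ∑ l, ‖(Uᵀ * S * U) k l‖ ^ 2 = ∑ k, ∑ l, ‖S k l‖ ^ 2 := by
    have : ((Uᵀ * S * U)ᴴ * (Uᵀ * S * U)).trace = (Sᴴ * S).trace := by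
      have h1 : (Uᵀ * S * U)ᴴ * (Uᵀ * S * U) = Uᴴ * (Sᴴ * (Uᴴᵀ * Uᵀ) * S * U) := by
        simp only [Matrix.conjTranspose_mul, Matrix.mul_assoc]
        rfl
      rw [h1, hU'', Matrix.trace_mul_comm, Matrix.mul_one, Matrix.mul_assoc _ U, hU',
        Matrix.mul_one]
    rw [trace_conjTranspose_mul_self_eq_sum, trace_conjTranspose_mul_self_eq_sum] at this
    exact_mod_cast this
  refine ⟨A * U, ?_, ?_⟩
  · rw [Matrix.conjTranspose_mul, Matrix.mul_assoc, ← Matrix.mul_assoc U, hU', Matrix.one_mul]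
  · rw [hT, ← hF]
    simp only [Fin.sum_univ_two, h00, norm_zero, zero_add]
    nlinarith [sq_nonneg ‖(Uᵀ * S * U) 0 1‖, sq_nonneg ‖(Uᵀ * S * U) 1 0‖]

/-- The squared harmony of a mixture of operators of rank two. -/
theorem harmony_sq_le_sum {K : ℕ} (p : Fin K → ℝ) (hp : ∀ i, 0 ≤ p i) (hp1 : ∑ i, p i = 1)
    (A : Fin K → Matrix Q2 Q1 ℂ) (htr : (∑ i, (p i : ℂ) • (A i * (A i)ᴴ)).trace = 1) :
    harmony (∑ i, (p i : ℂ) • (A i * (A i)ᴴ)) ^ 2 ≤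
      ∑ i, p i * ∑ k, ∑ l, ‖((A i)ᵀ * sigmaYY * A i) k l‖ ^ 2 := by
  choose b hb hbA using fun i => exists_two_column_ensemble (A i)
  let B : Matrix Q2 (Fin K × Q1) ℂ := Matrix.of fun a k => (√(p k.1) : ℂ) * b k.1 a k.2
  have hsq : ∀ i, ((√(p i) : ℝ) : ℂ) * ((√(p i) : ℝ) : ℂ) = p i := fun i => by
    exact_mod_cast Real.mul_self_sqrt (hp i)
  have hB : ∑ i, (p i : ℂ) • (A i * (A i)ᴴ) = B * Bᴴ := by
    ext a c
    rw [Matrix.sum_apply, Matrix.mul_apply, Fintype.sum_prod_type]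
    refine Finset.sum_congr rfl fun i _ => ?_
    rw [← hb, Matrix.smul_apply, Matrix.mul_apply, Finset.smul_sum]
    refine Finset.sum_congr rfl fun k _ => ?_
    simp only [B, Matrix.conjTranspose_apply, Matrix.of_apply, star_mul', smul_eq_mul, ← hsq i,
      RCLike.star_def, Complex.conj_ofReal]
    ring
  have hdiag : ∀ i k, ‖(Bᵀ * sigmaYY * B) (i, k) (i, k)‖
      = p i * ‖((b i)ᵀ * sigmaYY * b i) k k‖ := by
    intro i k
    have : (Bᵀ * sigmaYY * B) (i, k) (i, k) = p i * ((b i)ᵀ * sigmaYY * b i) k k := by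
      simp only [Matrix.mul_apply, Matrix.transpose_apply, B, Matrix.of_apply, Finset.mul_sum,
        Finset.sum_mul, ← hsq i]
      exact Finset.sum_congr rfl fun _ _ => Finset.sum_congr rfl fun _ _ => by ring
    rw [this, norm_mul, Complex.norm_real, Real.norm_of_nonneg (hp i)]
  rw [hB] at htr ⊢
  have h1 := harmony_le_sum_norm B htr
  simp only [Fintype.sum_prod_type, hdiag, ← Finset.mul_sum] at h1
  have h0 : 0 ≤ harmony (B * Bᴴ) := le_max_left _ _
  refine (pow_le_pow_left₀ h0 h1 2).trans ?_
  set s : Fin K → ℝ := fun i => ∑ k, ‖((b i)ᵀ * sigmaYY * b i) k k‖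
  -- Cauchy–Schwarz with weights `p` of total mass one.
  have h2 := Finset.sum_sq_le_sum_mul_sum_of_sq_le_mul Finset.univ (r := fun i => p i * s i)
    (f := p) (g := fun i => p i * s i ^ 2) (fun i _ => hp i)
    (fun i _ => mul_nonneg (hp i) (sq_nonneg _)) (fun i _ => le_of_eq (by ring))
  rw [hp1, one_mul] at h2
  exact h2.trans (Finset.sum_le_sum fun i _ => mul_le_mul_of_nonneg_left (hbA i) (hp i))

/-! ### Pure three-qubit states and the inequality for every decomposition. -/

/-- The columns `ψ(·, ·, z)`. -/
def columnsXY (ψ : Q3 → ℂ) : Matrix Q2 Q1 ℂ := Matrix.of fun a z => ψ (a.1, a.2, z)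

/-- The columns `ψ(·, y, ·)`. -/
def columnsXZ (ψ : Q3 → ℂ) : Matrix Q2 Q1 ℂ := Matrix.of fun a y => ψ (a.1, y, a.2)

theorem reduceXY_proj (ψ : Q3 → ℂ) : reduceXY (proj ψ) = columnsXY ψ * (columnsXY ψ)ᴴ := by
  ext a b
  simp [reduceXY, columnsXY, proj, Matrix.mul_apply, Matrix.vecMulVec_apply]

theorem reduceXZ_proj (ψ : Q3 → ℂ) : reduceXZ (proj ψ) = columnsXZ ψ * (columnsXZ ψ)ᴴ := by
  ext a b
  simp [reduceXZ, columnsXZ, proj, Matrix.mul_apply, Matrix.vecMulVec_apply]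

/-- The squared-concurrence identity of a pure three-qubit state. -/
theorem sum_norm_sq_add_sum_norm_sq (ψ : Q3 → ℂ) :
    ∑ k, ∑ l, ‖((columnsXY ψ)ᵀ * sigmaYY * columnsXY ψ) k l‖ ^ 2 +
      ∑ k, ∑ l, ‖((columnsXZ ψ)ᵀ * sigmaYY * columnsXZ ψ) k l‖ ^ 2
      = 4 * (ptraceRight (proj ψ)).det.re := by
  have h : ((∑ k, ∑ l, ‖((columnsXY ψ)ᵀ * sigmaYY * columnsXY ψ) k l‖ ^ 2 +
      ∑ k, ∑ l, ‖((columnsXZ ψ)ᵀ * sigmaYY * columnsXZ ψ) k l‖ ^ 2 : ℝ) : ℂ)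
      = 4 * (ptraceRight (proj ψ)).det := by
    have hsq : ∀ z : ℂ, ((‖z‖ ^ 2 : ℝ) : ℂ) = z * starRingEnd ℂ z := fun z => by
      rw [Complex.mul_conj']; push_cast; rfl
    simp only [Complex.ofReal_add, hsq, Matrix.det_fin_two, ptraceRight, proj,
      Matrix.of_apply, Matrix.vecMulVec_apply, Matrix.mul_apply, Fintype.sum_prod_type,
      Fin.sum_univ_two, columnsXY, columnsXZ, sigmaYY, sigmaY, Matrix.kroneckerMap_apply,
      Matrix.transpose_apply]
    simp
    ring
  have h' := congrArg Complex.re h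
  rwa [Complex.ofReal_re, ← Complex.ofReal_ofNat, Complex.re_ofReal_mul] at h'

theorem sqrt_harmonyX_YZ (ψ : Q3 → ℂ) :
    √(harmonyX_YZ ψ) = 4 * (ptraceRight (proj ψ)).det.re := by
  rw [harmonyX_YZ_eq, Real.sqrt_sq]
  rw [← sum_norm_sq_add_sum_norm_sq]
  positivity

theorem harmony_sq_add_harmony_sq_le {ρ : Matrix Q3 Q3 ℂ} {K : ℕ} {p : Fin K → ℝ}
    {ψ : Fin K → Q3 → ℂ} (hρ : ρ.trace = 1) (h : IsPureDecomposition ρ K p ψ) :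
    harmony (reduceXY ρ) ^ 2 + harmony (reduceXZ ρ) ^ 2 ≤ ∑ i, p i * √(harmonyX_YZ (ψ i)) := by
  have hXY : reduceXY ρ = ∑ i, (p i : ℂ) • (columnsXY (ψ i) * (columnsXY (ψ i))ᴴ) := by
    simp only [← reduceXY_proj, h.eq_sum]
    ext a b
    simp [reduceXY, Matrix.sum_apply, Finset.sum_add_distrib]
  have hXZ : reduceXZ ρ = ∑ i, (p i : ℂ) • (columnsXZ (ψ i) * (columnsXZ (ψ i))ᴴ) := by
    simp only [← reduceXZ_proj, h.eq_sum]
    ext a b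
    simp [reduceXZ, Matrix.sum_apply, Finset.sum_add_distrib]
  have tXY : (reduceXY ρ).trace = 1 := by
    rw [← hρ]
    simp [reduceXY, Matrix.trace, Fintype.sum_prod_type]
  have tXZ : (reduceXZ ρ).trace = 1 := by
    rw [← hρ]
    simp [reduceXZ, Matrix.trace, Fintype.sum_prod_type]
    ring
  rw [hXY] at tXY ⊢
  rw [hXZ] at tXZ ⊢
  refine (add_le_add (harmony_sq_le_sum p h.nonneg h.sum_eq_one _ tXY)
    (harmony_sq_le_sum p h.nonneg h.sum_eq_one _ tXZ)).trans_eq ?_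
  simp only [sqrt_harmonyX_YZ, ← sum_norm_sq_add_sum_norm_sq, mul_add, Finset.sum_add_distrib]

end Harmony

/-! ### Existence of the minimum by compactness. -/

/-- The convex hull of a compact set in a finite-dimensional space is compact. -/
theorem IsCompact.convexHull_of_finiteDimensional {E : Type*} [AddCommGroup E] [Module ℝ E]
    [TopologicalSpace E] [ContinuousAdd E] [ContinuousSMul ℝ E] [FiniteDimensional ℝ E]
    {s : Set E} (hs : IsCompact s) : IsCompact (convexHull ℝ s) := by
  obtain rfl | ⟨x₀, hx₀⟩ := s.eq_empty_or_nonempty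
  · simp
  let I := Fin (Module.finrank ℝ E + 1)
  let f : (I → ℝ) × (I → E) → E := fun q => ∑ i, q.1 i • q.2 i
  have hf : Continuous f := by fun_prop
  have himage : convexHull ℝ s = f '' (stdSimplex ℝ I ×ˢ Set.univ.pi fun _ => s) := by
    ext x
    constructor
    · intro hx
      -- Carathéodory bounds the number of points by the dimension plus one; unused slots get weight
      -- zero and the point `x₀`.
      obtain ⟨ι, _, z, w, hz, hai, hw, hw1, hx⟩ := eq_pos_convex_span_of_mem_convexHull hx
      have hcard : Fintype.card ι ≤ Fintype.card I := by
        rw [Fintype.card_fin]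
        exact hai.card_le_finrank_succ.trans (Nat.succ_le_succ (Submodule.finrank_le _))
      obtain ⟨g⟩ := Function.Embedding.nonempty_of_card_le hcard
      refine ⟨(Function.extend g w 0, Function.extend g z fun _ => x₀), ⟨⟨fun j => ?_, ?_⟩, ?_⟩, ?_⟩
      · by_cases hj : ∃ i, g i = j
        · obtain ⟨i, rfl⟩ := hj
          simpa [g.injective.extend_apply] using (hw i).le
        · simp [Function.extend_apply' _ _ _ hj]
      · rw [← hw1]
        exact Fintype.sum_of_injective g g.injective _ _
          (fun j hj => by simp [Function.extend_apply' _ _ _ hj])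
          (fun i => by simp [g.injective.extend_apply]) |>.symm
      · intro j _
        by_cases hj : ∃ i, g i = j
        · obtain ⟨i, rfl⟩ := hj
          simpa [g.injective.extend_apply] using hz ⟨i, rfl⟩
        · simpa [Function.extend_apply' _ _ _ hj] using hx₀
      · rw [← hx]
        exact Fintype.sum_of_injective g g.injective _ _
          (fun j hj => by simp [Function.extend_apply' _ _ _ hj])
          (fun i => by simp [g.injective.extend_apply]) |>.symm
    · rintro ⟨⟨w, z⟩, ⟨hw, hz⟩, rfl⟩
      exact mem_convexHull_of_exists_fintype w z hw.1 hw.2 (fun i => hz i trivial) rfl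
  rw [himage]
  exact ((isCompact_stdSimplex ℝ I).prod (isCompact_univ_pi fun _ => hs)).image hf

namespace Harmony

/-- The pure states, each paired with its value of `H_{X(YZ)} ^ (1/2)`. -/
def pureGraph : Set (Matrix Q3 Q3 ℂ × ℝ) :=
  (fun ψ => (proj ψ, √(harmonyX_YZ ψ))) '' {ψ | IsUnitVec ψ}

theorem isCompact_pureGraph : IsCompact pureGraph := by
  refine IsCompact.image ?_ ?_
  · refine Metric.isCompact_of_isClosed_isBounded ?_ ?_
    · exact isClosed_eq (by fun_prop) continuous_const
    · refine (Metric.isBounded_closedBall (x := (0 : Q3 → ℂ)) (r := 1)).subset fun ψ hψ => ?_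
      rw [mem_closedBall_zero_iff, pi_norm_le_iff_of_nonneg zero_le_one]
      intro i
      have := Finset.single_le_sum (f := fun i => ‖ψ i‖ ^ 2) (fun j _ => sq_nonneg _)
        (Finset.mem_univ i)
      rw [show ∑ i, ‖ψ i‖ ^ 2 = 1 from hψ] at this
      exact (sq_le_one_iff₀ (norm_nonneg _)).1 this
  · have hp : Continuous fun ψ : Q3 → ℂ => proj ψ :=
      continuous_id.matrix_vecMulVec continuous_star
    have ht : Continuous fun ψ : Q3 → ℂ => ptraceRight (proj ψ) :=
      continuous_matrix fun i j => by
        simp only [ptraceRight, Matrix.of_apply]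
        exact continuous_finsetSum _ fun w _ => hp.matrix_elem _ _
    -- The definition through a chosen effective qubit gives no continuity; the determinant formula
    -- does.
    simp only [sqrt_harmonyX_YZ]
    exact hp.prodMk (continuous_const.mul (Complex.continuous_re.comp ht.matrix_det))

/-- The state and the average are both linear in the weights, so a decomposition is a convex
combination of points of the graph. -/
theorem sqrtHarmonyAverages_eq (ρ : Matrix Q3 Q3 ℂ) :
    sqrtHarmonyAverages ρ = {v | (ρ, v) ∈ convexHull ℝ pureGraph} := by
  have hsmul : ∀ (c : ℝ) (M : Matrix Q3 Q3 ℂ), (c : ℂ) • M = c • M := fun c M => by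
    ext i j; simp
  ext v
  constructor
  · rintro ⟨K, p, ψ, h, rfl⟩
    refine mem_convexHull_of_exists_fintype p (fun i => (proj (ψ i), √(harmonyX_YZ (ψ i))))
      h.nonneg h.sum_eq_one (fun i => ⟨ψ i, h.unit i, rfl⟩) ?_
    rw [Prod.ext_iff]
    simp [Prod.fst_sum, Prod.snd_sum, h.eq_sum, hsmul]
  · intro hv
    obtain ⟨ι, _, w, z, hw, hw1, hz, hx⟩ := mem_convexHull_iff_exists_fintype.1 hv
    choose ψ hψ hψz using hz
    let e := (Fintype.equivFin ι).symm
    rw [Prod.ext_iff] at hx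
    simp only [Prod.fst_sum, Prod.snd_sum, ← hψz] at hx
    refine ⟨Fintype.card ι, w ∘ e, ψ ∘ e, ⟨fun i => hw _, ?_, fun i => hψ _, ?_⟩, ?_⟩
    · rw [← hw1]; exact e.sum_comp w
    · rw [← hx.1]
      simp only [hsmul]
      exact (e.sum_comp fun i => w i • proj (ψ i)).symm
    · rw [← hx.2]
      exact (e.sum_comp fun i => w i * √(harmonyX_YZ (ψ i))).symm

theorem sqrtHarmonyAverages_nonempty {ρ : Matrix Q3 Q3 ℂ} (hρ : IsDensity ρ) :
    (sqrtHarmonyAverages ρ).Nonempty := by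
  have hH := hρ.1.isHermitian
  -- The spectral decomposition serves as a pure-state decomposition.
  let ψ : Q3 → Q3 → ℂ := fun k => (hH.eigenvectorBasis k).ofLp
  refine ⟨∑ k, hH.eigenvalues k • √(harmonyX_YZ (ψ k)), ?_⟩
  rw [sqrtHarmonyAverages_eq]
  refine mem_convexHull_of_exists_fintype hH.eigenvalues
    (fun k => (proj (ψ k), √(harmonyX_YZ (ψ k)))) hρ.1.eigenvalues_nonneg ?_
    (fun k => ⟨ψ k, ?_, rfl⟩) ?_
  · have h := hH.trace_eq_sum_eigenvalues
    rw [hρ.2] at h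
    exact (Complex.ofReal_injective (by simpa using h)).symm
  · have h := hH.eigenvectorBasis.orthonormal.1 k
    rw [EuclideanSpace.norm_eq, Real.sqrt_eq_one] at h
    exact h
  · rw [Prod.ext_iff]
    refine ⟨?_, by simp [Prod.snd_sum]⟩
    refine Eq.trans ?_ hH.spectral_theorem.symm
    ext a b
    simp only [Prod.fst_sum, Prod.smul_fst, Matrix.sum_apply, Unitary.conjStarAlgAut_apply,
      Matrix.mul_apply (N := star _), Matrix.mul_diagonal, Matrix.smul_apply]
    refine Finset.sum_congr rfl fun k _ => ?_
    simp [proj, Matrix.vecMulVec_apply, ψ, Matrix.IsHermitian.eigenvectorUnitary_apply,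
      Matrix.star_apply]
    ring

theorem isCompact_sqrtHarmonyAverages (ρ : Matrix Q3 Q3 ℂ) :
    IsCompact (sqrtHarmonyAverages ρ) := by
  have h : sqrtHarmonyAverages ρ
      = Prod.snd '' (convexHull ℝ pureGraph ∩ Prod.fst ⁻¹' {ρ}) := by
    rw [sqrtHarmonyAverages_eq]
    ext v
    constructor
    · exact fun hv => ⟨(ρ, v), ⟨hv, rfl⟩, rfl⟩
    · rintro ⟨⟨_, _⟩, ⟨hv, rfl⟩, rfl⟩
      exact hv
  rw [h]
  exact (isCompact_pureGraph.convexHull_of_finiteDimensional.inter_right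
    (isClosed_singleton.preimage continuous_fst)).image continuous_snd

end Harmony

theorem mainTheorem3 (ρ : Matrix Harmony.Q3 Harmony.Q3 ℂ) (hρ : Harmony.IsDensity ρ) :
    IsLeast (Harmony.sqrtHarmonyAverages ρ) (Harmony.sqrtHarmonyMin ρ) ∧
      Harmony.harmony (Harmony.reduceXY ρ) ^ 2 + Harmony.harmony (Harmony.reduceXZ ρ) ^ 2 ≤
        Harmony.sqrtHarmonyMin ρ := by
  have h := (Harmony.isCompact_sqrtHarmonyAverages ρ).isLeast_sInf
    (Harmony.sqrtHarmonyAverages_nonempty hρ)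
  refine ⟨h, ?_⟩
  obtain ⟨K, p, ψ, hd, hv⟩ := h.1
  rw [Harmony.sqrtHarmonyMin, hv]
  exact Harmony.harmony_sq_add_harmony_sq_le hρ.2 hd
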